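/- **Setting.** Write $X\cdot Z$ for the composite functor $A\mapsto X(Z A)$. A *pointed endofunctor* of a category $\mathcal A$ is a pair $(Z,e)$ with $Z:\mathcal A\to\mathcal A$ and $e:\mathrm{Id}\to Z$ natural; with point-preserving natural transformations these form a category $\mathrm{Ptd}(\mathcal A)$, and $(Z',e')\cdot(Z,e)=(Z'\cdot Z,e'\cdot e)$. A *prestrength* for $H:[\mathcal A,\mathcal D']\to[\mathcal A,\mathcal D]$ is a family $\theta_{X,(Z,e)}:(HX)\cdot Z\to H(X\cdot Z)$ natural in $X\in[\mathcal A,\mathcal D']$ and $(Z,e)\in\mathrm{Ptd}(\mathcal A)$. It is a *strength* if $\theta_{X,\mathrm{Id}}=1_{HX}$ and, up to associativity of composition, $\theta_{X,Z'\cdot Z}=\theta_{X\cdot Z',Z}\circ(\theta_{X,Z'}\cdot Z)$. A *pointed distributive law* for $G:\mathcal A\to\mathcal A$ is a family $\delta_{(Z,e)}:G\cdot Z\to Z\cdot G$ natural in $(Z,e)\in\mathrm{Ptd}(\mathcal A)$ with $\delta_{\mathrm{Id}}=1_G$ and $\delta_{Z'\cdot Z}=(Z'\cdot\delta_Z)\circ(\delta_{Z'}\cdot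 Z)$. A functor is *$\omega$-cocontinuous* if it preserves colimits of chains $A_0\to A_1\to A_2\to\cdots$. Let $H$ be an endofunctor of $[\mathcal A,\mathcal A]$ with prestrength $\theta$, where $\mathcal A$ has binary coproducts. An algebra for $\mathrm{Id}+H:X\mapsto \mathrm{Id}_{\mathcal A}+HX$ is written $(T,[\eta,\tau])$ with $\eta:\mathrm{Id}\to T$ and $\tau:HT\to T$. For $f:(Z,e)\to(T,\eta)$ in $\mathrm{Ptd}(\mathcal A)$, a *bracket* of $f$ is a morphism $h:T\cdot Z\to T$ with $h\circ(\eta\cdot Z)=f$ and $h\circ(\tau\cdot Z)=\tau\circ Hh\circ\theta_{T,(Z,e)}$. The algebra is a *heterogeneous substitution system* (HSS) for $(H,\theta)$ if every such $f$ has exactly one bracket. We say that *$(H,\theta)$ has a term monad* if an initial $(\mathrm{Id}+H)$-algebra exists, and every initial $(\mathrm{Id}+H)$-algebra $(T,[\eta,\tau])$ is an HSS for $(H,\theta)$ and $(T,\eta,\mu)$ is a monad, where $\mu:T\cdot T\to T$ is the bracket of $1_{(T,\eta)}$. Let $S$ be a set (of sorts). A *multi-sorted binding signature* over $S$ is a small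 set $I$ with a map $\mathrm{ar}:I\to\mathrm{list}(\mathrm{list}(S)\times S)\times S$. Let $\mathcal C$ be a category with a terminal object $1$, binary products, binary coproducts and small coproducts, and let $\mathcal C^S=[S,\mathcal C]$ with $S$ discrete. For $s\in S$ define $$(\mathrm{option}_s X)\,t=X\,t+\coprod_{(s=t)}1,\qquad \mathrm{proj}_s X=X\,s,\qquad (\hat s\,B)\,t=\coprod_{(s=t)}B,$$ where $X\in\mathcal C^S$, $B\in\mathcal C$, and the coproducts are indexed by the set of proofs of $s=t$ (one element if $s=t$, none otherwise). Put $\mathrm{option}\,[\,]=\mathrm{Id}$ and $\mathrm{option}\,[s_1,\dots,s_n]=\mathrm{option}_{s_1}\cdot\ldots\cdot\mathrm{option}_{s_n}$. For $X:\mathcal C^S\to\mathcal C^S$ put $F^{(\ell,s)}X=\mathrm{proj}_s\cdot X\cdot\mathrm{option}\,\ell$ and $F^{([a_1,\dots,a_m],t)}X=\hat t\cdot(F^{a_1}X\times\cdots\times F^{a_m}X)$ (the constant functor $1$ in place of the product if $m=0$). The *signature functor* $H:[\mathcal C^S,\mathcal C^S]\to[\mathcal C^S,\mathcal C^S]$ is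 $HX=\coprod_{i\in I}F^{\mathrm{ar}(i)}X$, with products and coproducts formed pointwise. The prestrength $\theta$ of $H$ is built as follows. The law $\delta$ for $\mathrm{option}_s$ is $$Z\,X\,t+\coprod_{(s=t)}1\to Z(\mathrm{option}_sX)\,t,$$ given on the first summand by $Z$ applied to the inclusion $X\to\mathrm{option}_sX$, and on the second by the inclusion into $\mathrm{option}_sX$ followed by $e$. These laws are composed to one for $\mathrm{option}\,\ell$, which induces the prestrength $X\cdot\delta$ of precomposition with $\mathrm{option}\,\ell$. This is then carried through postcomposition with $\mathrm{proj}_s$, binary products, the constant functor $1$ (with identity prestrength), postcomposition with $\hat t$, and coproducts. **Theorem.** 1. Let $\mathcal A$ be a category with binary coproducts, an initial object and colimits of chains, let $H:[\mathcal A,\mathcal A]\to[\mathcal A,\mathcal A]$ be $\omega$-cocontinuous and $\theta$ a strength for $H$. Then $(H,\theta)$ has a term monad. 2. Let $(I,\mathrm{ar})$ be a multi-sorted binding signature over $S$, let $\mathcal C$ have a terminal object, binary products, binary coproducts and small coproducts, and let $(H,\theta)$ be built from it as above. Then the families $\delta$ for $\mathrm{option}_s$ and for $\mathrm{option}\,\ell$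 are pointed distributive laws, and $\theta$ is a strength for $H$. If moreover $\mathcal C$ has an initial object and colimits of chains and $H$ is $\omega$-cocontinuous, then $(H,\theta)$ has a term monad. 3. If $\mathcal C=\mathsf{Set}$, then for every multi-sorted binding signature the functor $H$ is $\omega$-cocontinuous and $(H,\theta)$ has a term monad. -/

import Mathlib

open CategoryTheory CategoryTheory.Limits

universe w x v u v₁ u₁ v₂ u₂ v₃ u₃ v₄ u₄

noncomputable section

namespace MultiSorted

/-! ### Pointed endofunctors -/

/-- A pointed endofunctor `(Z, e)` of `A`: an endofunctor `Z` with a natural transformation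
`e : 𝟭 A ⟶ Z`. -/
structure Ptd (A : Type u₁) [Category.{v₁} A] where
  /-- the underlying endofunctor -/
  functor : A ⥤ A
  /-- the point -/
  point : 𝟭 A ⟶ functor

namespace Ptd

variable {A : Type u₁} [Category.{v₁} A]

/-- A morphism of pointed endofunctors is a natural transformation that preserves the points. -/
@[ext]
structure Hom (Z Z' : Ptd A) where
  /-- the underlying natural transformation -/
  hom : Z.functor ⟶ Z'.functor
  w : Z.point ≫ hom = Z'.point

instance : Category (Ptd A) where
  Hom := Hom
  id Z := ⟨𝟙 _, Category.comp_id _⟩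
  comp f g := ⟨f.hom ≫ g.hom, by rw [← Category.assoc, f.w, g.w]⟩

/-- The identity pointed endofunctor `(Id, 1)`. -/
def unit (A : Type u₁) [Category.{v₁} A] : Ptd A where
  functor := 𝟭 A
  point := 𝟙 _

/-- The composite pointed endofunctor `(Z' · Z, e' · e)`, where `(Z' · Z) X = Z' (Z X)`. -/
def comp (Z' Z : Ptd A) : Ptd A where
  functor := Z.functor ⋙ Z'.functor
  point :=
    { app := fun X => Z.point.app X ≫ Z'.point.app (Z.functor.obj X)
      naturality := fun X Y f => by
        have h₁ := Z.point.naturality f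
        have h₂ := Z'.point.naturality (Z.functor.map f)
        dsimp at h₁ h₂ ⊢
        rw [← Category.assoc, h₁, Category.assoc, h₂, Category.assoc] }

end Ptd

/-! ### Signatures with strength and pointed distributive laws -/

section Strength

variable {A : Type u₁} [Category.{v₁} A] {D' : Type u₂} [Category.{v₂} D']
  {D : Type u₃} [Category.{v₃} D] {E : Type u₄} [Category.{v₄} E]

/-- A prestrength for `H : [A, D'] ⥤ [A, D]`: a natural transformation
`θ_{X,(Z,e)} : (H X) · Z ⟶ H (X · Z)` of bifunctors `[A, D'] × Ptd A ⥤ [A, D]`.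
Mathlib writes `Z ⋙ X` for the composite `X · Z`. -/
structure Prestrength (H : (A ⥤ D') ⥤ (A ⥤ D)) where
  /-- the components -/
  app (X : A ⥤ D') (Z : Ptd A) : Z.functor ⋙ H.obj X ⟶ H.obj (Z.functor ⋙ X)
  naturality_left {X X' : A ⥤ D'} (f : X ⟶ X') (Z : Ptd A) :
    Functor.whiskerLeft Z.functor (H.map f) ≫ app X' Z =
      app X Z ≫ H.map (Functor.whiskerLeft Z.functor f)
  naturality_right (X : A ⥤ D') {Z Z' : Ptd A} (g : Z ⟶ Z') :
    Functor.whiskerRight g.hom (H.obj X) ≫ app X Z' =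
      app X Z ≫ H.map (Functor.whiskerRight g.hom X)

/-- The two strength laws for a prestrength `θ`: `θ_{X, Id} = 1_{H X}` and
`θ_{X, Z' · Z} = H(α⁻¹) ∘ θ_{X · Z', Z} ∘ (θ_{X, Z'} · Z)`. -/
structure IsStrength {H : (A ⥤ D') ⥤ (A ⥤ D)} (θ : Prestrength H) : Prop where
  unit (X : A ⥤ D') :
    θ.app X (Ptd.unit A) = (Functor.leftUnitor (H.obj X)).hom ≫ H.map (Functor.leftUnitor X).inv
  comp (X : A ⥤ D') (Z' Z : Ptd A) :
    θ.app X (Z'.comp Z) =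
      (Functor.associator Z.functor Z'.functor (H.obj X)).hom ≫
        Functor.whiskerLeft Z.functor (θ.app X Z') ≫
          θ.app (Z'.functor ⋙ X) Z ≫
            H.map (Functor.associator Z.functor Z'.functor X).inv

/-- The data of a pointed distributive law for `G`: a natural transformation
`δ_{(Z,e)} : G · Z ⟶ Z · G` of functors `Ptd A ⥤ [A, A]`. -/
structure PreDistr (G : A ⥤ A) where
  /-- the components -/
  app (Z : Ptd A) : Z.functor ⋙ G ⟶ G ⋙ Z.functor
  naturality {Z Z' : Ptd A} (g : Z ⟶ Z') :
    Functor.whiskerRight g.hom G ≫ app Z' = app Z ≫ Functor.whiskerLeft G g.hom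

/-- The laws of a pointed distributive law: `δ_Id = 1_G` and
`δ_{Z' · Z} = (Z' · δ_Z) ∘ (δ_{Z'} · Z)`. -/
structure IsDistributiveLaw {G : A ⥤ A} (δ : PreDistr G) : Prop where
  unit (X : A) : (δ.app (Ptd.unit A)).app X = 𝟙 (G.obj X)
  comp (Z' Z : Ptd A) (X : A) :
    (δ.app (Z'.comp Z)).app X =
      (δ.app Z').app (Z.functor.obj X) ≫ Z'.functor.map ((δ.app Z).app X)

/-- The trivial distributive law for the identity functor. -/
def PreDistr.id (A : Type u₁) [Category.{v₁} A] : PreDistr (𝟭 A) where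
  app Z := (Functor.rightUnitor Z.functor).hom ≫ (Functor.leftUnitor Z.functor).inv
  naturality g := by ext X; simp

/-- Distributive laws for `G₁` and `G₂` give one for `G₁ · G₂`:
`G₁ G₂ Z ⟶ G₁ Z G₂ ⟶ Z G₁ G₂`. -/
def PreDistr.comp {G₁ G₂ : A ⥤ A} (δ₁ : PreDistr G₁) (δ₂ : PreDistr G₂) :
    PreDistr (G₂ ⋙ G₁) where
  app Z :=
    { app := fun X => G₁.map ((δ₂.app Z).app X) ≫ (δ₁.app Z).app (G₂.obj X)
      naturality := fun X Y f => by
        have h₁ := (δ₂.app Z).naturality f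
        have h₂ := (δ₁.app Z).naturality (G₂.map f)
        dsimp at h₁ h₂ ⊢
        rw [← Category.assoc, ← G₁.map_comp, h₁, G₁.map_comp, Category.assoc, h₂,
          Category.assoc] }
  naturality {Z Z'} g := by
    ext X
    have h₁ := NatTrans.congr_app (δ₂.naturality g) X
    have h₂ := NatTrans.congr_app (δ₁.naturality g) (G₂.obj X)
    dsimp at h₁ h₂ ⊢
    rw [← Category.assoc, ← G₁.map_comp, h₁, G₁.map_comp, Category.assoc, h₂, Category.assoc]

/-- The prestrength, induced by a distributive law for `G`, for precomposition with `G`,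
`X ↦ X · G`: its components are `X · δ_Z : X · G · Z ⟶ X · Z · G`. -/
def Prestrength.precomp (D' : Type u₂) [Category.{v₂} D'] {G : A ⥤ A} (δ : PreDistr G) :
    Prestrength ((Functor.whiskeringLeft A A D').obj G) where
  app X Z :=
    { app := fun a => X.map ((δ.app Z).app a)
      naturality := fun a b f => by
        have h := congrArg X.map ((δ.app Z).naturality f)
        rw [X.map_comp, X.map_comp] at h
        exact h }
  naturality_left f Z := by
    ext a
    exact (f.naturality ((δ.app Z).app a)).symm
  naturality_right X _ _ g := by
    ext a
    have h := congrArg X.map (NatTrans.congr_app (δ.naturality g) a)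
    rw [NatTrans.comp_app, NatTrans.comp_app, X.map_comp, X.map_comp] at h
    exact h

/-- A prestrength for `H` gives one for `X ↦ K · H X`, with components `K · θ_{X,Z}`. -/
def Prestrength.postcomp {H : (A ⥤ D') ⥤ (A ⥤ D)} (θ : Prestrength H) (K : D ⥤ E) :
    Prestrength (H ⋙ (Functor.whiskeringRight A D E).obj K) where
  app X Z :=
    { app := fun a => K.map ((θ.app X Z).app a)
      naturality := fun a b f => by
        have h := congrArg K.map ((θ.app X Z).naturality f)
        rw [K.map_comp, K.map_comp] at h
        exact h }
  naturality_left f Z := by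
    ext a
    have h := congrArg K.map (NatTrans.congr_app (θ.naturality_left f Z) a)
    rw [NatTrans.comp_app, NatTrans.comp_app, K.map_comp, K.map_comp] at h
    exact h
  naturality_right X _ _ g := by
    ext a
    have h := congrArg K.map (NatTrans.congr_app (θ.naturality_right X g) a)
    rw [NatTrans.comp_app, NatTrans.comp_app, K.map_comp, K.map_comp] at h
    exact h

/-- The functor `[A, D'] ⥤ [A, D]` whose value is always the constant functor `d`. -/
def constSig (A : Type u₁) [Category.{v₁} A] (D' : Type u₂) [Category.{v₂} D'] (d : D) :
    (A ⥤ D') ⥤ (A ⥤ D) :=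
  (Functor.const (A ⥤ D')).obj ((Functor.const A).obj d)

/-- The identity prestrength of a constant functor. -/
def Prestrength.const (A : Type u₁) [Category.{v₁} A] (D' : Type u₂) [Category.{v₂} D'] (d : D) :
    Prestrength (constSig A D' d) where
  app _ _ := { app := fun _ => 𝟙 d }
  naturality_left _ _ := rfl
  naturality_right _ _ _ _ := rfl

/-- The pointwise binary product `(H₁ × H₂) X a = H₁ X a × H₂ X a`. -/
def prodSig [HasBinaryProducts D] (H₁ H₂ : (A ⥤ D') ⥤ (A ⥤ D)) : (A ⥤ D') ⥤ (A ⥤ D) where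
  obj X :=
    { obj := fun a => (H₁.obj X).obj a ⨯ (H₂.obj X).obj a
      map := fun f => prod.map ((H₁.obj X).map f) ((H₂.obj X).map f) }
  map α := { app := fun a => prod.map ((H₁.map α).app a) ((H₂.map α).app a) }

/-- The prestrength of a pointwise binary product, `θ₁ × θ₂`. -/
def Prestrength.prod [HasBinaryProducts D] {H₁ H₂ : (A ⥤ D') ⥤ (A ⥤ D)}
    (θ₁ : Prestrength H₁) (θ₂ : Prestrength H₂) : Prestrength (prodSig H₁ H₂) where
  app X Z :=
    { app := fun a => prod.map ((θ₁.app X Z).app a) ((θ₂.app X Z).app a)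
      naturality := fun _ _ f =>
        (prod.map_map _ _ _ _).trans ((congrArg₂ prod.map ((θ₁.app X Z).naturality f)
          ((θ₂.app X Z).naturality f)).trans (prod.map_map _ _ _ _).symm) }
  naturality_left f Z := by
    ext a : 2
    exact (prod.map_map _ _ _ _).trans ((congrArg₂ prod.map
      (NatTrans.congr_app (θ₁.naturality_left f Z) a)
      (NatTrans.congr_app (θ₂.naturality_left f Z) a)).trans (prod.map_map _ _ _ _).symm)
  naturality_right X _ _ g := by
    ext a : 2
    exact (prod.map_map _ _ _ _).trans ((congrArg₂ prod.map
      (NatTrans.congr_app (θ₁.naturality_right X g) a)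
      (NatTrans.congr_app (θ₂.naturality_right X g) a)).trans (prod.map_map _ _ _ _).symm)

/-- The pointwise coproduct `(∐ H) X a = ∐ i, H i X a`. -/
def sumSig {I : Type w} [HasCoproductsOfShape I D] (H : I → (A ⥤ D') ⥤ (A ⥤ D)) :
    (A ⥤ D') ⥤ (A ⥤ D) where
  obj X :=
    { obj := fun a => ∐ fun i => ((H i).obj X).obj a
      map := fun f => Limits.Sigma.map fun i => ((H i).obj X).map f }
  map α := { app := fun a => Limits.Sigma.map fun i => ((H i).map α).app a }

/-- The prestrength of a pointwise coproduct, `∐ θ`. -/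
def Prestrength.sum {I : Type w} [HasCoproductsOfShape I D] {H : I → (A ⥤ D') ⥤ (A ⥤ D)}
    (θ : ∀ i, Prestrength (H i)) : Prestrength (sumSig H) where
  app X Z :=
    { app := fun a => Limits.Sigma.map fun i => ((θ i).app X Z).app a
      naturality := fun _ _ f =>
        (Sigma.map_comp_map _ _).trans ((congrArg Limits.Sigma.map
          (funext fun i => ((θ i).app X Z).naturality f)).trans (Sigma.map_comp_map _ _).symm) }
  naturality_left f Z := by
    ext a : 2
    exact (Sigma.map_comp_map _ _).trans ((congrArg Limits.Sigma.map
      (funext fun i => NatTrans.congr_app ((θ i).naturality_left f Z) a)).trans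
        (Sigma.map_comp_map _ _).symm)
  naturality_right X _ _ g := by
    ext a : 2
    exact (Sigma.map_comp_map _ _).trans ((congrArg Limits.Sigma.map
      (funext fun i => NatTrans.congr_app ((θ i).naturality_right X g) a)).trans
        (Sigma.map_comp_map _ _).symm)

end Strength

/-! ### Multi-sorted binding signatures -/

/-- A multi-sorted binding signature over the sorts `S`. Each constructor `i : I` has a list of
arguments, each given by the sorts of the variables bound in it and its own sort, and a result
sort. -/
structure MultiSortedSig (S : Type x) where
  /-- the constructors -/
  I : Type w
  /-- the arities -/
  ar : I → List (List S × S) × S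

section Functors

variable (C : Type u) [Category.{v} C] {S : Type x}

/-- The category `C^S`, with `S` a discrete category. -/
abbrev Sorted (C : Type u) [Category.{v} C] (S : Type x) := Discrete S ⥤ C

/-- The proposition `s = t` as an index type. -/
abbrev EqIdx (s t : S) : Type w := ULift.{w} (PLift (s = t))

/-- The projection functor `proj_s X = X s`. -/
abbrev projSort (s : S) : Sorted C S ⥤ C := (evaluation (Discrete S) C).obj ⟨s⟩

variable [HasCoproducts.{w} C]

/-- The hat functor `(hat_s X) t = ∐_{s = t} X`. -/
def hatFunctor (s : S) : C ⥤ Sorted C S where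
  obj X := Discrete.functor fun t => ∐ fun _ : EqIdx.{w} s t => X
  map f := Discrete.natTrans fun t =>
    Limits.Sigma.map (β := EqIdx.{w} s t.as) (f := fun _ => _) (g := fun _ => _) fun _ => f
  map_id X := by
    ext ⟨t⟩ : 2
    exact Sigma.map_id (f := fun _ : EqIdx.{w} s t => X)
  map_comp {X Y Z} f g := by
    ext ⟨t⟩ : 2
    exact (Sigma.map_comp_map (f := fun _ : EqIdx.{w} s t => X) (g := fun _ => Y)
      (h := fun _ => Z) (fun _ => f) fun _ => g).symm

variable [HasTerminal C] [HasBinaryCoproducts C]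

/-- The sorted option functor `(option_s X) t = X t + ∐_{s = t} 1`. -/
def optionFunctor (s : S) : Sorted C S ⥤ Sorted C S where
  obj X := Discrete.functor fun t => X.obj ⟨t⟩ ⨿ ∐ fun _ : EqIdx.{w} s t => ⊤_ C
  map f := Discrete.natTrans fun t => coprod.map (f.app t) (𝟙 _)
  map_id X := by
    ext ⟨t⟩ : 2
    exact coprod.map_id_id
  map_comp f g := by
    ext ⟨t⟩ : 2
    simp

/-- The inclusion of `X` into `option_s X`. -/
def optionInl (s : S) : 𝟭 (Sorted C S) ⟶ optionFunctor.{w} C s where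
  app X := Discrete.natTrans fun _ => coprod.inl
  naturality X Y f := by
    ext ⟨t⟩ : 2
    exact (coprod.inl_map _ _).symm

/-- The distributive law for `option_s`. Its component
`option_s (Z X) t = Z X t + ∐_{s = t} 1 ⟶ Z (option_s X) t` is `Z` of the inclusion
`X ⟶ option_s X` on the first summand, and the inclusion of the new variable into `option_s X`
followed by the point of `Z` on the second. -/
def optionDistr (s : S) : PreDistr (optionFunctor.{w} C s) where
  app Z :=
    { app := fun X => Discrete.natTrans fun t =>
        coprod.desc ((Z.functor.map ((optionInl.{w} C s).app X)).app t)
          ((coprod.inr : _ ⟶ X.obj ⟨t.as⟩ ⨿ ∐ fun _ : EqIdx.{w} s t.as => ⊤_ C) ≫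
            (Z.point.app ((optionFunctor.{w} C s).obj X)).app t)
      naturality := fun X Y f => by
        ext ⟨t⟩ : 2
        have h₁ := congrArg Z.functor.map ((optionInl.{w} C s).naturality f)
        rw [Functor.map_comp, Functor.map_comp] at h₁
        have h₁ := NatTrans.congr_app h₁ ⟨t⟩
        have h₂ := NatTrans.congr_app
          (Z.point.naturality ((optionFunctor.{w} C s).map f)) ⟨t⟩
        refine coprod.hom_ext ?_ ?_
        · refine (coprod.inl_map_assoc _ _ _).trans ?_
          refine (whisker_eq _ (coprod.inl_desc _ _)).trans ?_
          exact h₁.trans (coprod.inl_desc_assoc _ _ _).symm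
        · refine (coprod.inr_map_assoc _ _ _).trans ?_
          refine (Category.id_comp _).trans ((coprod.inr_desc _ _).trans ?_)
          refine .trans ?_ (coprod.inr_desc_assoc _ _ _).symm
          refine .trans ?_ (Category.assoc _ _ _).symm
          refine .trans ?_ (whisker_eq _ h₂)
          refine .trans ?_ (Category.assoc _ _ _)
          refine eq_whisker ?_ _
          exact ((coprod.inr_map _ _).trans (Category.id_comp _)).symm }
  naturality {Z Z'} g := by
    ext X ⟨t⟩ : 4
    have h₁ := NatTrans.congr_app (g.hom.naturality ((optionInl.{w} C s).app X)) ⟨t⟩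
    have h₂ := NatTrans.congr_app (NatTrans.congr_app g.w ((optionFunctor.{w} C s).obj X)) ⟨t⟩
    refine coprod.hom_ext ?_ ?_
    · refine (coprod.inl_map_assoc _ _ _).trans ?_
      refine (whisker_eq _ (coprod.inl_desc _ _)).trans ?_
      exact h₁.symm.trans (coprod.inl_desc_assoc _ _ _).symm
    · refine (coprod.inr_map_assoc _ _ _).trans ?_
      refine (Category.id_comp _).trans ((coprod.inr_desc _ _).trans ?_)
      refine .trans ?_ (coprod.inr_desc_assoc _ _ _).symm
      refine .trans ?_ (Category.assoc _ _ _).symm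
      exact whisker_eq _ h₂.symm

/-- `option ℓ = option_{s₁} · (option_{s₂} · …)` for `ℓ = [s₁, …, sₙ]`, and `option [] = Id`. -/
def optionList : List S → Sorted C S ⥤ Sorted C S
  | [] => 𝟭 _
  | s :: ℓ => optionList ℓ ⋙ optionFunctor.{w} C s

/-- The distributive law for `option ℓ`, composed from those for the `option_s`. -/
def optionListDistr : (ℓ : List S) → PreDistr (optionList.{w} C ℓ)
  | [] => PreDistr.id _
  | s :: ℓ => PreDistr.comp (optionDistr.{w} C s) (optionListDistr ℓ)

/-- `F^(ℓ,s) X = proj_s · X · option ℓ`. -/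
def argFunctor (a : List S × S) : (Sorted C S ⥤ Sorted C S) ⥤ (Sorted C S ⥤ C) :=
  (Functor.whiskeringLeft _ _ _).obj (optionList.{w} C a.1) ⋙
    (Functor.whiskeringRight _ _ _).obj (projSort C a.2)

/-- The strength of `F^(ℓ,s)`. -/
def argStrength (a : List S × S) : Prestrength (argFunctor.{w} C a) :=
  (Prestrength.precomp (Sorted C S) (optionListDistr.{w} C a.1)).postcomp (projSort C a.2)

variable [HasBinaryProducts C]

/-- The product `F^{a₁} × (F^{a₂} × …)`: the constant functor `1` for the empty list, and just
`F^a` for the list `[a]`. -/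
def argsFunctor : List (List S × S) → (Sorted C S ⥤ Sorted C S) ⥤ (Sorted C S ⥤ C)
  | [] => constSig _ _ (⊤_ C)
  | [a] => argFunctor.{w} C a
  | a :: b :: l => prodSig (argFunctor.{w} C a) (argsFunctor (b :: l))

/-- The strength of the product of the `F^{aᵢ}`. -/
def argsStrength : (l : List (List S × S)) → Prestrength (argsFunctor.{w} C l)
  | [] => Prestrength.const _ _ (⊤_ C)
  | [a] => argStrength.{w} C a
  | a :: b :: l => Prestrength.prod (argStrength.{w} C a) (argsStrength (b :: l))

/-- `F^(as,t) X = hat_t · (F^{a₁} X × … × F^{aₘ} X)`. -/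
def arityFunctor (a : List (List S × S) × S) :
    (Sorted C S ⥤ Sorted C S) ⥤ (Sorted C S ⥤ Sorted C S) :=
  argsFunctor.{w} C a.1 ⋙ (Functor.whiskeringRight _ _ _).obj (hatFunctor.{w} C a.2)

/-- The strength of `F^(as,t)`. -/
def arityStrength (a : List (List S × S) × S) : Prestrength (arityFunctor.{w} C a) :=
  (argsStrength.{w} C a.1).postcomp (hatFunctor.{w} C a.2)

/-- The signature functor `H X = ∐ i, F^{ar i} X`. -/
def MultiSortedSig.functor (σ : MultiSortedSig.{w} S) :
    (Sorted C S ⥤ Sorted C S) ⥤ (Sorted C S ⥤ Sorted C S) :=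
  sumSig fun i => arityFunctor.{w} C (σ.ar i)

/-- The strength of the signature functor. -/
def MultiSortedSig.strength (σ : MultiSortedSig.{w} S) : Prestrength (σ.functor C) :=
  Prestrength.sum fun i => arityStrength.{w} C (σ.ar i)

end Functors

/-! ### Substitution systems and the term monad -/

section Substitution

variable {A : Type u} [Category.{v} A] [HasBinaryCoproducts A]

/-- The functor `Id + H`, `X ↦ 𝟭 A ⨿ H X`, on `[A, A]`. -/
abbrev idPlus (H : (A ⥤ A) ⥤ (A ⥤ A)) : (A ⥤ A) ⥤ (A ⥤ A) :=
  H ⋙ coprod.functor.obj (𝟭 A)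

/-- The `(Id + H)`-algebra `(T, [η, τ])`. -/
def mkAlg {H : (A ⥤ A) ⥤ (A ⥤ A)} (T : A ⥤ A) (η : 𝟭 A ⟶ T) (τ : H.obj T ⟶ T) :
    Endofunctor.Algebra (idPlus H) where
  a := T
  str := coprod.desc η τ

variable {H : (A ⥤ A) ⥤ (A ⥤ A)}

/-- The component `η` of an `(Id + H)`-algebra `(T, [η, τ])`. -/
def algEta (T : Endofunctor.Algebra (idPlus H)) : 𝟭 A ⟶ T.a :=
  (coprod.inl : 𝟭 A ⟶ 𝟭 A ⨿ H.obj T.a) ≫ T.str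

/-- The component `τ` of an `(Id + H)`-algebra `(T, [η, τ])`. -/
def algTau (T : Endofunctor.Algebra (idPlus H)) : H.obj T.a ⟶ T.a :=
  (coprod.inr : H.obj T.a ⟶ 𝟭 A ⨿ H.obj T.a) ≫ T.str

/-- The pointed endofunctor `(T, η)` of an `(Id + H)`-algebra `(T, [η, τ])`. -/
def algPtd (T : Endofunctor.Algebra (idPlus H)) : Ptd A where
  functor := T.a
  point := algEta T

/-- For `f : (Z, e) ⟶ (T, η)`, the morphism `h : T · Z ⟶ T` satisfies
`h ∘ (η · Z) = f` and `h ∘ (τ · Z) = τ ∘ H h ∘ θ_{T,(Z,e)}`. -/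
structure IsBracket (θ : Prestrength H) (T : Endofunctor.Algebra (idPlus H)) {Z : Ptd A}
    (f : Z ⟶ algPtd T) (h : Z.functor ⋙ T.a ⟶ T.a) : Prop where
  eta : (Functor.rightUnitor Z.functor).inv ≫ Functor.whiskerLeft Z.functor (algEta T) ≫ h = f.hom
  tau : Functor.whiskerLeft Z.functor (algTau T) ≫ h = θ.app T.a Z ≫ H.map h ≫ algTau T

/-- The algebra `T` is a heterogeneous substitution system for `(H, θ)`. -/
def IsHSS (θ : Prestrength H) (T : Endofunctor.Algebra (idPlus H)) : Prop :=
  ∀ (Z : Ptd A) (f : Z ⟶ algPtd T), ∃! h : Z.functor ⋙ T.a ⟶ T.a, IsBracket θ T f h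

/-- An initial `(Id + H)`-algebra exists, and every initial algebra `(T, [η, τ])` is a
heterogeneous substitution system for `(H, θ)` and carries a monad `(T, η, μ)`, with the `η` of
the algebra as its unit, and as its multiplication `μ` the (unique) bracket of the identity of
`(T, η)`, that is the substitution `T · T ⟶ T` which is homomorphic on the constructors. -/
def HasTermMonad (θ : Prestrength H) : Prop :=
  HasInitial (Endofunctor.Algebra (idPlus H)) ∧
    ∀ T : Endofunctor.Algebra (idPlus H), Nonempty (IsInitial T) →
      IsHSS θ T ∧
        ∃ (M : Monad A) (τ : H.obj M.toFunctor ⟶ M.toFunctor),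
          T = mkAlg M.toFunctor M.η τ ∧
            IsBracket θ (mkAlg M.toFunctor M.η τ) (𝟙 (algPtd (mkAlg M.toFunctor M.η τ))) M.μ

end Substitution

end MultiSorted

end

open MultiSorted

/-! Since `H` is ω-cocontinuous, so is `Id + H` (ℕ is connected, so the constant summand `Id` does
no harm), and every initial algebra `T` is the colimit of the chain `⊥ ⟶ F ⊥ ⟶ F (F ⊥) ⟶ ⋯` for `F =
Id + H`. A bracket is a map out of `T · Z`, not out of `T`, so initiality alone does not produce it.
But precomposition with `Z` preserves colimits and the initial object, because these are computed
pointwise, so `T · Z` is the colimit of the chain `(Fⁿ ⊥) · Z`. A map out of it is built and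
determined stage by stage (`existsUnique_iteration`). The recursion step `h ↦ [f, τ ∘ H h ∘ θ]` is
natural because `θ` is, so brackets exist uniquely for any prestrength (`isHSS_of_isInitial`).

The monad laws come from uniqueness of brackets. One unit law is a bracket equation. For the other
unit law and for associativity, both sides are brackets of the same pointed map: precomposing a
bracket gives a bracket by naturality of `θ` in `Z`, while the identity and composites are brackets
by the two strength laws.

For binding signatures, each construction preserves the strength laws, so everything reduces to the
distributive law of `option_s`. Over sets, ω-cocontinuity reduces pointwise to two facts: coproducts
commute with colimits, and finite products commute with filtered colimits. -/

noncomputable section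

namespace MultiSorted

/-! ### Initial algebras and generalized iteration -/

section InitialChain

variable {C : Type u₁} [Category.{v₁} C] [HasInitial C] (F : C ⥤ C)

/-- The objects `Fⁿ ⊥` of the initial chain. -/
def chainObj : ℕ → C
  | 0 => ⊥_ C
  | n + 1 => F.obj (chainObj n)

/-- The transition morphisms of the initial chain. -/
def chainStep : (n : ℕ) → (chainObj F n ⟶ chainObj F (n + 1))
  | 0 => initial.to _
  | n + 1 => F.map (chainStep n)

/-- The initial chain `⊥ ⟶ F ⊥ ⟶ F (F ⊥) ⟶ ⋯`. -/
def initialChain : ℕ ⥤ C := Functor.ofSequence (chainStep F)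

variable {F}

/-- A sequence of morphisms that is compatible with the initial chain is a cocone over its image
under a functor. -/
def chainCocone {D : Type u₂} [Category.{v₂} D] (L : C ⥤ D) {X : D}
    (g : ∀ n, L.obj (chainObj F n) ⟶ X) (hg : ∀ n, L.map (chainStep F n) ≫ g (n + 1) = g n) :
    Cocone (initialChain F ⋙ L) where
  pt := X
  ι := NatTrans.ofSequence g fun n => by
    have h : (initialChain F).map (homOfLE (n.le_add_right 1)) = chainStep F n :=
      Functor.ofSequence_map_homOfLE_succ _ n
    simp only [Functor.comp_map, h, Functor.const_obj_map]
    exact (hg n).trans (Category.comp_id _).symm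

/-- The morphisms from the initial chain to an algebra. -/
def algLeg (T : Endofunctor.Algebra F) : (n : ℕ) → (chainObj F n ⟶ T.a)
  | 0 => initial.to _
  | n + 1 => F.map (algLeg T n) ≫ T.str

lemma chainStep_algLeg (T : Endofunctor.Algebra F) (n : ℕ) :
    chainStep F n ≫ algLeg T (n + 1) = algLeg T n := by
  induction n with
  | zero => exact initialIsInitial.hom_ext _ _
  | succ n ih =>
    change F.map (chainStep F n) ≫ F.map (algLeg T (n + 1)) ≫ T.str = F.map (algLeg T n) ≫ T.str
    rw [← Functor.map_comp_assoc, ih]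

/-- The cocone from the initial chain to an algebra. -/
def algCocone (T : Endofunctor.Algebra F) : Cocone (initialChain F) where
  pt := T.a
  ι := (chainCocone (𝟭 C) (algLeg T) (chainStep_algLeg T)).ι

/-- Generalized iteration in Mendler style: on the colimit of the initial chain, a recursion
scheme `Ψ` has exactly one solution. -/
theorem existsUnique_iteration {T : Endofunctor.Algebra F} (hT : IsColimit (algCocone T))
    [PreservesColimitsOfShape ℕ F] {D : Type u₂} [Category.{v₂} D] (L : C ⥤ D)
    [PreservesColimitsOfShape ℕ L] (hL : IsInitial (L.obj (⊥_ C))) (X : D)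
    (Ψ : ∀ Y : C, (L.obj Y ⟶ X) → (L.obj (F.obj Y) ⟶ X))
    (hΨ : ∀ (Y Y' : C) (f : Y ⟶ Y') (h : L.obj Y' ⟶ X),
      Ψ Y (L.map f ≫ h) = L.map (F.map f) ≫ Ψ Y' h) :
    ∃! h : L.obj T.a ⟶ X, L.map T.str ≫ h = Ψ T.a h := by
  -- The solution restricted to stage `n`: iterate `Ψ`, starting from the only map out of the
  -- initial object `L ⊥`.
  let g : ∀ n, L.obj (chainObj F n) ⟶ X := fun n =>
    Nat.rec (motive := fun n => L.obj (chainObj F n) ⟶ X) (hL.to X) (fun n g => Ψ _ g) n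
  have hg : ∀ n, L.map (chainStep F n) ≫ g (n + 1) = g n := by
    intro n
    induction n with
    | zero => exact hL.hom_ext _ _
    | succ n ih =>
      change L.map (F.map (chainStep F n)) ≫ Ψ _ (g (n + 1)) = Ψ _ (g n)
      rw [← hΨ, ih]
  -- Two colimits are needed: maps out of `L T` are built and compared using `h₁`, while the
  -- equation to be solved lives on `L (F T)` and is tested using `h₂`.
  have h₁ := isColimitOfPreserves L hT
  have h₂ := isColimitOfPreserves L (isColimitOfPreserves F hT)
  obtain ⟨d, fac⟩ : ∃ d : L.obj T.a ⟶ X, ∀ n, L.map (algLeg T n) ≫ d = g n :=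
    ⟨h₁.desc (chainCocone L g hg), h₁.fac (chainCocone L g hg)⟩
  refine ⟨d, h₂.hom_ext fun n => ?_, fun h hh => ?_⟩
  -- By definition `F (algLeg T n) ≫ T.str` is leg `n + 1`, so both sides restrict to `g (n + 1) = Ψ
  -- (g n)`.
  · change L.map (F.map (algLeg T n)) ≫ L.map T.str ≫ _ = L.map (F.map (algLeg T n)) ≫ Ψ T.a _
    rw [← Functor.map_comp_assoc, ← hΨ, fac n]
    exact fac (n + 1)
  · refine h₁.hom_ext fun n => .trans ?_ (fac n).symm
    change L.map (algLeg T n) ≫ h = g n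
    induction n with
    | zero => exact hL.hom_ext _ _
    | succ n ih =>
      change L.map (F.map (algLeg T n) ≫ T.str) ≫ h = Ψ _ (g n)
      rw [Functor.map_comp, Category.assoc, hh, ← hΨ, ih]

/-- An algebra on the colimit of the initial chain is initial. -/
def isInitialOfIsColimit [PreservesColimitsOfShape ℕ F] {T : Endofunctor.Algebra F}
    (hT : IsColimit (algCocone T)) : IsInitial T := by
  have key (B : Endofunctor.Algebra F) : ∃! h : T.a ⟶ B.a, T.str ≫ h = F.map h ≫ B.str :=
    -- For `L = 𝟭` and this `Ψ`, the solutions are exactly the algebra morphisms `T ⟶ B`.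
    existsUnique_iteration hT (𝟭 C) initialIsInitial B.a (fun Y h => F.map h ≫ B.str)
      (fun Y Y' f h => by simp)
  exact IsInitial.ofUniqueHom (fun B => ⟨(key B).choose, (key B).choose_spec.1.symm⟩)
    (fun B m => Endofunctor.Algebra.ext ((key B).choose_spec.2 m.f m.h.symm))

/-- The algebra on the colimit of the initial chain. -/
def chainAlgebra (F : C ⥤ C) [HasColimitsOfShape ℕ C] [PreservesColimitsOfShape ℕ F] :
    Endofunctor.Algebra F where
  a := colimit (initialChain F)
  -- `F` of the colimit is the colimit of the shifted chain, whence the legs with index `n + 1`.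
  str := (isColimitOfPreserves F (colimit.isColimit (initialChain F))).desc
    (chainCocone F (fun n => colimit.ι (initialChain F) (n + 1)) fun n =>
      (congrArg (· ≫ colimit.ι (initialChain F) (n + 1 + 1))
        (Functor.ofSequence_map_homOfLE_succ (chainStep F) (n + 1)).symm).trans
        (colimit.w (initialChain F) (homOfLE ((n + 1).le_add_right 1))))

lemma algLeg_chainAlgebra (F : C ⥤ C) [HasColimitsOfShape ℕ C] [PreservesColimitsOfShape ℕ F]
    (n : ℕ) : algLeg (chainAlgebra F) n = colimit.ι (initialChain F) n := by
  induction n with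
  | zero => exact initialIsInitial.hom_ext _ _
  | succ n ih =>
    change F.map (algLeg (chainAlgebra F) n) ≫ _ = _
    rw [ih]
    exact (isColimitOfPreserves F (colimit.isColimit (initialChain F))).fac _ n

/-- The cocone of `chainAlgebra F` is a colimit. -/
def isColimitChainAlgebra (F : C ⥤ C) [HasColimitsOfShape ℕ C] [PreservesColimitsOfShape ℕ F] :
    IsColimit (algCocone (chainAlgebra F)) :=
  (colimit.isColimit (initialChain F)).ofIsoColimit
    (Cocone.ext (Iso.refl _) fun n => (Category.comp_id _).trans (algLeg_chainAlgebra F n).symm)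

lemma algLeg_comp {T T' : Endofunctor.Algebra F} (f : T ⟶ T') (n : ℕ) :
    algLeg T n ≫ f.f = algLeg T' n := by
  induction n with
  | zero => exact initialIsInitial.hom_ext _ _
  | succ n ih =>
    change (F.map (algLeg T n) ≫ T.str) ≫ f.f = F.map (algLeg T' n) ≫ T'.str
    rw [Category.assoc, ← f.h, ← Functor.map_comp_assoc, ih]

/-- Every initial algebra is the colimit of the initial chain. -/
def isColimitOfIsInitial [HasColimitsOfShape ℕ C] [PreservesColimitsOfShape ℕ F]
    {T : Endofunctor.Algebra F} (hT : IsInitial T) : IsColimit (algCocone T) :=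
  let e : chainAlgebra F ≅ T := (isInitialOfIsColimit (isColimitChainAlgebra F)).uniqueUpToIso hT
  (isColimitChainAlgebra F).ofIsoColimit
    (Cocone.ext ((Endofunctor.Algebra.forget F).mapIso e) fun n => algLeg_comp e.hom n)

end InitialChain

/-- Taking the coproduct with a fixed object preserves connected colimits. -/
lemma preservesColimitsOfShape_coprod {C : Type u₁} [Category.{v₁} C] [HasBinaryCoproducts C]
    (J : Type u₂) [Category.{v₂} J] [IsConnected J] (X : C) :
    PreservesColimitsOfShape J (coprod.functor.obj X) where
  preservesColimit {K} := ⟨fun {c} hc => ⟨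
    let γ : K ⟶ K ⋙ coprod.functor.obj X :=
      { app := fun j => coprod.inr
        naturality := fun i j f => (coprod.inr_map _ _).symm }
    -- The restrictions of a cocone to the summand `X` form a transformation between constant
    -- functors. Connectedness makes it constant, so any `j₀` may define the map on `X`.
    let α (s : Cocone (K ⋙ coprod.functor.obj X)) :
        (Functor.const J).obj X ⟶ (Functor.const J).obj s.pt :=
      { app := fun j => (coprod.inl : X ⟶ X ⨿ K.obj j) ≫ s.ι.app j
        naturality := fun i j f => by
          refine (Category.id_comp _).trans (.trans ?_ (Category.comp_id _).symm)
          refine .trans ?_ (whisker_eq (coprod.inl : X ⟶ X ⨿ K.obj i) (s.w f))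
          exact ((coprod.inl_map_assoc (𝟙 X) (K.map f) _).trans (Category.id_comp _)).symm }
    let j₀ : J := Classical.arbitrary J
    { desc := fun s => coprod.desc ((coprod.inl : X ⟶ X ⨿ K.obj j₀) ≫ s.ι.app j₀)
        (hc.desc ⟨s.pt, γ ≫ s.ι⟩)
      fac := fun s j => by
        refine coprod.hom_ext (X := X) (Y := K.obj j) ?_ ?_
        · refine (coprod.inl_map_assoc _ _ _).trans ((Category.id_comp _).trans ?_)
          refine (coprod.inl_desc _ _).trans ?_
          exact nat_trans_from_is_connected (α s) j₀ j
        · refine (coprod.inr_map_assoc _ _ _).trans ?_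
          refine (whisker_eq _ (coprod.inr_desc _ _)).trans ?_
          exact hc.fac ⟨s.pt, γ ≫ s.ι⟩ j
      uniq := fun s m hm => by
        refine coprod.hom_ext ?_ ?_
        · refine .trans ?_ (coprod.inl_desc _ _).symm
          rw [← hm j₀]
          exact ((coprod.inl_map_assoc _ _ _).trans (Category.id_comp _)).symm
        · refine .trans ?_ (coprod.inr_desc _ _).symm
          refine hc.hom_ext fun j => ?_
          refine .trans ?_ (hc.fac ⟨s.pt, γ ≫ s.ι⟩ j).symm
          change _ = coprod.inr ≫ s.ι.app j
          rw [← hm j]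
          exact (coprod.inr_map_assoc _ _ _).symm } ⟩⟩

/-! ### Substitution on initial algebras -/

section TermMonad

variable {A : Type u} [Category.{v} A] [HasBinaryCoproducts A] {H : (A ⥤ A) ⥤ (A ⥤ A)}

lemma idPlus_preservesColimitsOfShape_nat (H : (A ⥤ A) ⥤ (A ⥤ A))
    [PreservesColimitsOfShape ℕ H] : PreservesColimitsOfShape ℕ (idPlus H) :=
  have := preservesColimitsOfShape_coprod ℕ (𝟭 A)
  inferInstance

/-! ### Morphisms out of `(P ⨿ Q) · Z` -/

section WhiskerCoprod

variable (Z : A ⥤ A) {P Q X : A ⥤ A}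

/-- Precomposition with `Z` sends coproducts of functors to coproducts. -/
def whiskerLeftCoprodIsColimit (P Q : A ⥤ A) :
    IsColimit (BinaryCofan.mk (Functor.whiskerLeft Z (coprod.inl : P ⟶ P ⨿ Q))
      (Functor.whiskerLeft Z (coprod.inr : Q ⟶ P ⨿ Q))) :=
  mapIsColimitOfPreservesOfIsColimit ((Functor.whiskeringLeft A A A).obj Z) _ _
    (coprodIsCoprod P Q)

lemma whiskerLeft_coprod_hom_ext {h k : Z ⋙ (P ⨿ Q) ⟶ X}
    (h₁ : Functor.whiskerLeft Z coprod.inl ≫ h = Functor.whiskerLeft Z coprod.inl ≫ k)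
    (h₂ : Functor.whiskerLeft Z coprod.inr ≫ h = Functor.whiskerLeft Z coprod.inr ≫ k) : h = k :=
  BinaryCofan.IsColimit.hom_ext (whiskerLeftCoprodIsColimit Z P Q) h₁ h₂

/-- The morphism out of the coproduct `(P ⨿ Q) · Z` with the given components. -/
def whiskerDesc (f : Z ⋙ P ⟶ X) (g : Z ⋙ Q ⟶ X) : Z ⋙ (P ⨿ Q) ⟶ X :=
  (whiskerLeftCoprodIsColimit Z P Q).desc (BinaryCofan.mk f g)

lemma inl_whiskerDesc (f : Z ⋙ P ⟶ X) (g : Z ⋙ Q ⟶ X) :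
    Functor.whiskerLeft Z coprod.inl ≫ whiskerDesc Z f g = f :=
  (whiskerLeftCoprodIsColimit Z P Q).fac (BinaryCofan.mk f g) ⟨.left⟩

lemma inr_whiskerDesc (f : Z ⋙ P ⟶ X) (g : Z ⋙ Q ⟶ X) :
    Functor.whiskerLeft Z coprod.inr ≫ whiskerDesc Z f g = g :=
  (whiskerLeftCoprodIsColimit Z P Q).fac (BinaryCofan.mk f g) ⟨.right⟩

lemma whiskerLeft_map_whiskerDesc {P' Q' : A ⥤ A} (p : P' ⟶ P) (q : Q' ⟶ Q) (f : Z ⋙ P ⟶ X)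
    (g : Z ⋙ Q ⟶ X) :
    Functor.whiskerLeft Z (coprod.map p q) ≫ whiskerDesc Z f g =
      whiskerDesc Z (Functor.whiskerLeft Z p ≫ f) (Functor.whiskerLeft Z q ≫ g) := by
  apply whiskerLeft_coprod_hom_ext
  · rw [inl_whiskerDesc, ← Category.assoc, ← Functor.whiskerLeft_comp, coprod.inl_map,
      Functor.whiskerLeft_comp, Category.assoc, inl_whiskerDesc]
  · rw [inr_whiskerDesc, ← Category.assoc, ← Functor.whiskerLeft_comp, coprod.inr_map,
      Functor.whiskerLeft_comp, Category.assoc, inr_whiskerDesc]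

/-- Translates between the single fixed-point equation of `existsUnique_iteration` and the pair of
bracket equations, with `s = [η, τ]`. -/
lemma whiskerLeft_comp_eq_whiskerDesc_iff {T : A ⥤ A} (s : P ⨿ Q ⟶ T) (h : Z ⋙ T ⟶ X)
    (f : Z ⋙ P ⟶ X) (g : Z ⋙ Q ⟶ X) :
    Functor.whiskerLeft Z s ≫ h = whiskerDesc Z f g ↔
      Functor.whiskerLeft Z (coprod.inl ≫ s) ≫ h = f ∧
        Functor.whiskerLeft Z (coprod.inr ≫ s) ≫ h = g := by
  rw [Functor.whiskerLeft_comp, Functor.whiskerLeft_comp, Category.assoc, Category.assoc]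
  refine ⟨fun e => ?_, fun e => whiskerLeft_coprod_hom_ext Z ?_ ?_⟩
  · rw [e]
    exact ⟨inl_whiskerDesc Z f g, inr_whiskerDesc Z f g⟩
  · rw [e.1, inl_whiskerDesc]
  · rw [e.2, inr_whiskerDesc]

end WhiskerCoprod

lemma isBracket_iff (θ : Prestrength H) {T : Endofunctor.Algebra (idPlus H)} {Z : Ptd A}
    (f : Z ⟶ algPtd T) (h : Z.functor ⋙ T.a ⟶ T.a) :
    IsBracket θ T f h ↔
      Functor.whiskerLeft Z.functor (algEta T) ≫ h =
          (Functor.rightUnitor Z.functor).hom ≫ f.hom ∧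
        Functor.whiskerLeft Z.functor (algTau T) ≫ h = θ.app T.a Z ≫ H.map h ≫ algTau T :=
  ⟨fun hh => ⟨(Iso.inv_comp_eq (Functor.rightUnitor Z.functor)).1 hh.eta, hh.tau⟩,
    fun hh => ⟨(Iso.inv_comp_eq (Functor.rightUnitor Z.functor)).2 hh.1, hh.2⟩⟩

/-- If `H` is `ω`-cocontinuous, initial algebras are heterogeneous substitution systems. -/
theorem isHSS_of_isInitial [HasInitial A] [HasColimitsOfShape ℕ A] [PreservesColimitsOfShape ℕ H]
    (θ : Prestrength H) {T : Endofunctor.Algebra (idPlus H)} (hT : IsInitial T) : IsHSS θ T := by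
  intro Z f
  have := idPlus_preservesColimitsOfShape_nat H
  -- Naturality of the recursion step in `Y`: the variable summand does not involve `Y`, and on the
  -- other one it is naturality of `θ` in its functor argument.
  have hΨ (e : Z.functor ⟶ T.a) (Y Y' : A ⥤ A) (g : Y ⟶ Y') (h : Z.functor ⋙ Y' ⟶ T.a) :
      whiskerDesc Z.functor ((Functor.rightUnitor Z.functor).hom ≫ e)
          (θ.app Y Z ≫ H.map (Functor.whiskerLeft Z.functor g ≫ h) ≫ algTau T) =
        Functor.whiskerLeft Z.functor (coprod.map (𝟙 (𝟭 A)) (H.map g)) ≫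
          whiskerDesc Z.functor ((Functor.rightUnitor Z.functor).hom ≫ e)
            (θ.app Y' Z ≫ H.map h ≫ algTau T) := by
    rw [whiskerLeft_map_whiskerDesc, Functor.whiskerLeft_id', Category.id_comp,
      ← Category.assoc (Functor.whiskerLeft _ _), θ.naturality_left, H.map_comp]
    simp only [Category.assoc]
  -- Iterate with `L = (-) · Z` and `Ψ h = [f, τ ∘ H h ∘ θ]`.
  obtain ⟨h, hh, hu⟩ := existsUnique_iteration (isColimitOfIsInitial hT)
    ((Functor.whiskeringLeft A A A).obj Z.functor) (initialIsInitial.isInitialObj _ _) T.a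
    (fun Y h => whiskerDesc Z.functor ((Functor.rightUnitor Z.functor).hom ≫ f.hom)
      (θ.app Y Z ≫ H.map h ≫ algTau T)) (hΨ f.hom)
  refine ⟨h, (isBracket_iff θ f h).2 ?_, fun h' hh' => hu h' ?_⟩
  · exact (whiskerLeft_comp_eq_whiskerDesc_iff Z.functor T.str h _ _).1 hh
  · exact (whiskerLeft_comp_eq_whiskerDesc_iff Z.functor T.str h' _ _).2
      ((isBracket_iff θ f h').1 hh')

variable {θ : Prestrength H} {T : Endofunctor.Algebra (idPlus H)}

lemma IsBracket.eta_app {Z : Ptd A} {f : Z ⟶ algPtd T} {h : Z.functor ⋙ T.a ⟶ T.a}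
    (hh : IsBracket θ T f h) (a : A) :
    (algEta T).app (Z.functor.obj a) ≫ h.app a = f.hom.app a :=
  (Category.id_comp _).symm.trans (NatTrans.congr_app hh.eta a)

/-- Brackets are stable under precomposition. -/
lemma IsBracket.precomp {Z Z' : Ptd A} {f : Z ⟶ algPtd T} {h : Z.functor ⋙ T.a ⟶ T.a}
    (hh : IsBracket θ T f h) (g : Z' ⟶ Z) :
    IsBracket θ T (g ≫ f) (Functor.whiskerRight g.hom T.a ≫ h) where
  eta := by
    ext a
    refine (Category.id_comp _).trans ?_
    change (algEta T).app _ ≫ T.a.map (g.hom.app a) ≫ h.app a = g.hom.app a ≫ f.hom.app a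
    rw [← Category.assoc, ← (algEta T).naturality, Category.assoc, hh.eta_app]
    rfl
  tau := by
    -- The interchange law moves `g` in front of `τ`; naturality of `θ` in `Z` then moves it past
    -- `θ`.
    have h₁ : Functor.whiskerLeft Z'.functor (algTau T) ≫ Functor.whiskerRight g.hom T.a =
        Functor.whiskerRight g.hom (H.obj T.a) ≫ Functor.whiskerLeft Z.functor (algTau T) := by
      ext a
      exact ((algTau T).naturality (g.hom.app a)).symm
    rw [← Category.assoc, h₁, Category.assoc, hh.tau, ← Category.assoc, θ.naturality_right,
      H.map_comp, Category.assoc, Category.assoc]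

/-- The `τ` half of `IsBracket.comp`, where `t`, `t'`, `t₁`, `t₂` stand for components of `θ`. Push
`τ` through `h'`, slide `H h'` past `t` by naturality, and push `τ` through `h`; the composition law
`ht₂` reassembles `t'` and `t₁` into `t₂`, and the associators cancel. -/
lemma whiskerLeft_algTau_comp {Z Z' : A ⥤ A} {h : Z ⋙ T.a ⟶ T.a} {h' : Z' ⋙ T.a ⟶ T.a}
    {t : Z ⋙ H.obj T.a ⟶ H.obj (Z ⋙ T.a)} {t' : Z' ⋙ H.obj T.a ⟶ H.obj (Z' ⋙ T.a)}
    {t₁ : Z ⋙ H.obj (Z' ⋙ T.a) ⟶ H.obj (Z ⋙ Z' ⋙ T.a)}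
    {t₂ : (Z ⋙ Z') ⋙ H.obj T.a ⟶ H.obj ((Z ⋙ Z') ⋙ T.a)}
    (hh : Functor.whiskerLeft Z (algTau T) ≫ h = t ≫ H.map h ≫ algTau T)
    (hh' : Functor.whiskerLeft Z' (algTau T) ≫ h' = t' ≫ H.map h' ≫ algTau T)
    (ht : Functor.whiskerLeft Z (H.map h') ≫ t = t₁ ≫ H.map (Functor.whiskerLeft Z h'))
    (ht₂ : t₂ = (Functor.associator Z Z' (H.obj T.a)).hom ≫ Functor.whiskerLeft Z t' ≫
      t₁ ≫ H.map (Functor.associator Z Z' T.a).inv) :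
    Functor.whiskerLeft (Z ⋙ Z') (algTau T) ≫ (Functor.associator Z Z' T.a).hom ≫
        Functor.whiskerLeft Z h' ≫ h =
      t₂ ≫ H.map ((Functor.associator Z Z' T.a).hom ≫ Functor.whiskerLeft Z h' ≫ h) ≫
        algTau T := by
  have h₁ : Functor.whiskerLeft (Z ⋙ Z') (algTau T) ≫ (Functor.associator Z Z' T.a).hom =
      (Functor.associator Z Z' (H.obj T.a)).hom ≫
        Functor.whiskerLeft Z (Functor.whiskerLeft Z' (algTau T)) := by
    ext a
    exact (Category.comp_id _).trans (Category.id_comp _).symm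
  rw [← Category.assoc, h₁, Category.assoc, ← Category.assoc (Functor.whiskerLeft _ _),
    ← Functor.whiskerLeft_comp, hh', ht₂, H.map_comp, H.map_comp]
  simp only [Functor.whiskerLeft_comp, Category.assoc, hh]
  rw [← Category.assoc (Functor.whiskerLeft Z (H.map h')), ht]
  simp only [Category.assoc]
  rw [← Category.assoc (H.map (Functor.associator Z Z' T.a).inv), ← H.map_comp,
    Iso.inv_hom_id, H.map_id, Category.id_comp]

/-- By the unit law the unitors under `H` cancel, leaving `τ` on both sides. -/
lemma whiskerLeft_algTau_leftUnitor {t : 𝟭 A ⋙ H.obj T.a ⟶ H.obj (𝟭 A ⋙ T.a)}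
    (ht : t = (Functor.leftUnitor (H.obj T.a)).hom ≫ H.map (Functor.leftUnitor T.a).inv) :
    Functor.whiskerLeft (𝟭 A) (algTau T) ≫ (Functor.leftUnitor T.a).hom =
      t ≫ H.map (Functor.leftUnitor T.a).hom ≫ algTau T := by
  rw [ht, Category.assoc, ← Category.assoc (H.map _), ← H.map_comp, Iso.inv_hom_id,
    H.map_id, Category.id_comp]
  ext a
  exact (Category.comp_id _).trans (Category.id_comp _).symm

/-- The composite of a bracket for `Z'`, whiskered with `Z`, and a bracket for `Z` is a bracket
for `Z' · Z`. -/
lemma IsBracket.comp (hθ : IsStrength θ) {Z Z' : Ptd A} {f : Z ⟶ algPtd T}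
    {h : Z.functor ⋙ T.a ⟶ T.a} (hh : IsBracket θ T f h) {f' : Z' ⟶ algPtd T}
    {h' : Z'.functor ⋙ T.a ⟶ T.a} (hh' : IsBracket θ T f' h') (k : Z'.comp Z ⟶ algPtd T)
    (hk : k.hom = Functor.whiskerLeft Z.functor f'.hom ≫ h) :
    IsBracket θ T k ((Functor.associator Z.functor Z'.functor T.a).hom ≫
      Functor.whiskerLeft Z.functor h' ≫ h) where
  eta := by
    rw [hk]
    ext a
    refine (Category.id_comp _).trans ((whisker_eq _ (Category.id_comp _)).trans ?_)
    refine (Category.assoc _ _ _).symm.trans ?_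
    exact eq_whisker (hh'.eta_app _) _
  tau := whiskerLeft_algTau_comp hh.tau hh'.tau (θ.naturality_left h' Z) (hθ.comp T.a Z' Z)

/-- The identity of `T` is a bracket for the unit. -/
lemma isBracket_unit (hθ : IsStrength θ) (k : Ptd.unit A ⟶ algPtd T) (hk : k.hom = algEta T) :
    IsBracket θ T k (Functor.leftUnitor T.a).hom where
  eta := by
    rw [hk]
    ext a
    exact (Category.id_comp _).trans (Category.comp_id _)
  tau := whiskerLeft_algTau_leftUnitor (hθ.unit T.a)

/-- A heterogeneous substitution system for a strength carries a monad. -/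
def monadOfIsBracket (hθ : IsStrength θ) (hT : IsHSS θ T) (μ : T.a ⋙ T.a ⟶ T.a)
    (hμ : IsBracket θ T (𝟙 (algPtd T)) μ) : Monad A where
  toFunctor := T.a
  η := algEta T
  μ := μ
  left_unit a := hμ.eta_app a
  right_unit a := by
    -- Both `μ ∘ (T · η)` and the identity of `T` are brackets of `η : (Id, 1) ⟶ (T, η)`.
    let k : Ptd.unit A ⟶ algPtd T := ⟨algEta T, Category.id_comp _⟩
    have h₁ := hμ.precomp k
    rw [Category.comp_id] at h₁
    exact NatTrans.congr_app ((hT _ k).unique h₁ (isBracket_unit hθ k rfl)) a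
  assoc a := by
    -- By the left unit law `μ` preserves points, so it is itself a map that has a bracket. Both `μ
    -- ∘ (T · μ)` (precomposition) and `μ ∘ (μ · T)` (composition) are brackets of it.
    let k : (algPtd T).comp (algPtd T) ⟶ algPtd T := ⟨μ, by
      ext a
      refine (Category.assoc _ _ _).trans ?_
      exact (whisker_eq _ (hμ.eta_app a)).trans (Category.comp_id _)⟩
    have h₁ := hμ.precomp k
    rw [Category.comp_id] at h₁
    have h₂ := hμ.comp hθ hμ k (by
      ext a
      exact (Category.id_comp _).symm)
    refine (NatTrans.congr_app ((hT _ k).unique h₁ h₂) a).trans ?_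
    exact Category.id_comp _

/-- Every `ω`-cocontinuous signature with strength has a term monad. -/
theorem hasTermMonad_of_isStrength [HasInitial A] [HasColimitsOfShape ℕ A]
    (hθ : IsStrength θ) (hH : PreservesColimitsOfShape ℕ H) : HasTermMonad θ := by
  have := idPlus_preservesColimitsOfShape_nat H
  refine ⟨(isInitialOfIsColimit (isColimitChainAlgebra (idPlus H))).hasInitial, ?_⟩
  rintro T ⟨hT⟩
  have hHSS := isHSS_of_isInitial θ hT
  refine ⟨hHSS, ?_⟩
  have hE : T = mkAlg T.a (algEta T) (algTau T) := by
    have h₁ : T.str = coprod.desc (algEta T) (algTau T) :=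
      coprod.hom_ext (coprod.inl_desc _ _).symm (coprod.inr_desc _ _).symm
    obtain ⟨a, s⟩ := T
    exact congrArg (Endofunctor.Algebra.mk a) h₁
  obtain ⟨μ, hμ, -⟩ := hHSS _ (𝟙 (algPtd T))
  refine ⟨monadOfIsBracket hθ hHSS μ hμ, algTau T, hE, ?_⟩
  -- `hE` is only a propositional equality, so the bracket is transported along it; `HEq` records
  -- that the transported morphism is still `μ`.
  have hB : ∀ (T' : Endofunctor.Algebra (idPlus H)), T = T' →
      ∃ ν : T'.a ⋙ T'.a ⟶ T'.a, IsBracket θ T' (𝟙 (algPtd T')) ν ∧ HEq μ ν := by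
    rintro _ rfl
    exact ⟨μ, hμ, HEq.rfl⟩
  obtain ⟨ν, hν, e⟩ := hB _ hE
  obtain rfl := eq_of_heq e
  exact hν

end TermMonad

/-! ### Strengths and distributive laws -/

section StrengthLaws

variable {A : Type u₁} [Category.{v₁} A] {D' : Type u₂} [Category.{v₂} D']
  {D : Type u₃} [Category.{v₃} D] {E : Type u₄} [Category.{v₄} E]

/-- On components, a unitor outside `H` is an identity and disappears; the one under `H` must stay,
since `H` is arbitrary. -/
lemma IsStrength.unit_app {H : (A ⥤ D') ⥤ (A ⥤ D)} {θ : Prestrength H} (hθ : IsStrength θ)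
    (X : A ⥤ D') (a : A) :
    (θ.app X (Ptd.unit A)).app a = (H.map (Functor.leftUnitor X).inv).app a :=
  (NatTrans.congr_app (hθ.unit X) a).trans (Category.id_comp _)

lemma IsStrength.comp_app {H : (A ⥤ D') ⥤ (A ⥤ D)} {θ : Prestrength H} (hθ : IsStrength θ)
    (X : A ⥤ D') (Z' Z : Ptd A) (a : A) :
    (θ.app X (Z'.comp Z)).app a = (θ.app X Z').app (Z.functor.obj a) ≫
      (θ.app (Z'.functor ⋙ X) Z).app a ≫
        (H.map (Functor.associator Z.functor Z'.functor X).inv).app a :=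
  (NatTrans.congr_app (hθ.comp X Z' Z) a).trans (Category.id_comp _)

/-- The strength laws can be checked on components. -/
lemma IsStrength.of_app {H : (A ⥤ D') ⥤ (A ⥤ D)} {θ : Prestrength H}
    (h₁ : ∀ (X : A ⥤ D') (a : A),
      (θ.app X (Ptd.unit A)).app a = (H.map (Functor.leftUnitor X).inv).app a)
    (h₂ : ∀ (X : A ⥤ D') (Z' Z : Ptd A) (a : A),
      (θ.app X (Z'.comp Z)).app a = (θ.app X Z').app (Z.functor.obj a) ≫
        (θ.app (Z'.functor ⋙ X) Z).app a ≫
          (H.map (Functor.associator Z.functor Z'.functor X).inv).app a) : IsStrength θ where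
  unit X := by
    ext a
    exact (h₁ X a).trans (Category.id_comp _).symm
  comp X Z' Z := by
    ext a
    exact (h₂ X Z' Z a).trans (Category.id_comp _).symm

lemma IsDistributiveLaw.id : IsDistributiveLaw (PreDistr.id A) where
  unit _ := Category.comp_id _
  comp Z' Z X := by
    refine (Category.comp_id _).trans (.trans ?_ (Category.assoc _ _ _).symm)
    refine .trans ?_ (Category.id_comp _).symm
    refine .trans ?_ (Category.id_comp _).symm
    exact (congrArg Z'.functor.map (Category.comp_id _)).trans (Z'.functor.map_id _) |>.symm

/-- The composite of distributive laws is a distributive law. -/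
lemma isDistributiveLaw_comp {G₁ G₂ : A ⥤ A} {δ₁ : PreDistr G₁} {δ₂ : PreDistr G₂}
    (h₁ : IsDistributiveLaw δ₁) (h₂ : IsDistributiveLaw δ₂) :
    IsDistributiveLaw (PreDistr.comp δ₁ δ₂) where
  unit X := by
    change G₁.map ((δ₂.app (Ptd.unit A)).app X) ≫ (δ₁.app (Ptd.unit A)).app (G₂.obj X) = _
    rw [h₂.unit, h₁.unit]
    exact (Category.comp_id _).trans (G₁.map_id _)
  comp Z' Z X := by
    change G₁.map ((δ₂.app (Z'.comp Z)).app X) ≫ (δ₁.app (Z'.comp Z)).app (G₂.obj X) =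
      (G₁.map ((δ₂.app Z').app (Z.functor.obj X)) ≫ (δ₁.app Z').app (G₂.obj (Z.functor.obj X))) ≫
        Z'.functor.map (G₁.map ((δ₂.app Z).app X) ≫ (δ₁.app Z).app (G₂.obj X))
    -- The two laws act in the order `δ₂, δ₂, δ₁, δ₁` on one side and `δ₂, δ₁, δ₂, δ₁` on the other;
    -- this naturality square swaps the middle two.
    have h₃ := (δ₁.app Z').naturality ((δ₂.app Z).app X)
    refine (congrArg₂ (fun f g => G₁.map f ≫ g) (h₂.comp Z' Z X)
      (h₁.comp Z' Z (G₂.obj X))).trans ?_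
    refine (eq_whisker (G₁.map_comp _ _) _).trans ((Category.assoc _ _ _).trans ?_)
    refine .trans ?_ ((whisker_eq _ (Z'.functor.map_comp _ _)).trans (Category.assoc _ _ _)).symm
    refine whisker_eq _ ?_
    refine (Category.assoc _ _ _).symm.trans (.trans ?_ (Category.assoc _ _ _))
    exact eq_whisker h₃ _

lemma IsStrength.precomp {G : A ⥤ A} {δ : PreDistr G} (hδ : IsDistributiveLaw δ) :
    IsStrength (Prestrength.precomp D' δ) :=
  .of_app (fun X a => (congrArg X.map (hδ.unit a)).trans (X.map_id _)) fun X Z' Z a => by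
    refine (congrArg X.map (hδ.comp Z' Z a)).trans ((X.map_comp _ _).trans ?_)
    exact whisker_eq _ (Category.comp_id _).symm

lemma IsStrength.postcomp {H : (A ⥤ D') ⥤ (A ⥤ D)} {θ : Prestrength H} (hθ : IsStrength θ)
    (K : D ⥤ E) : IsStrength (θ.postcomp K) :=
  .of_app (fun X a => congrArg K.map (hθ.unit_app X a)) fun X Z' Z a =>
    (congrArg K.map (hθ.comp_app X Z' Z a)).trans
      ((K.map_comp _ _).trans (whisker_eq _ (K.map_comp _ _)))

lemma IsStrength.const (d : D) : IsStrength (Prestrength.const A D' d) :=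
  .of_app (fun _ _ => rfl) fun _ _ _ _ =>
    ((Category.id_comp _).trans (Category.id_comp (𝟙 d))).symm

lemma IsStrength.prod [HasBinaryProducts D] {H₁ H₂ : (A ⥤ D') ⥤ (A ⥤ D)}
    {θ₁ : Prestrength H₁} {θ₂ : Prestrength H₂} (h₁ : IsStrength θ₁) (h₂ : IsStrength θ₂) :
    IsStrength (θ₁.prod θ₂) :=
  .of_app (fun X a => congrArg₂ Limits.prod.map (h₁.unit_app X a) (h₂.unit_app X a))
    fun X Z' Z a =>
      (congrArg₂ Limits.prod.map (h₁.comp_app X Z' Z a) (h₂.comp_app X Z' Z a)).trans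
        ((prod.map_map _ _ _ _).symm.trans (whisker_eq _ (prod.map_map _ _ _ _).symm))

lemma IsStrength.sum {I : Type w} [HasCoproductsOfShape I D] {H : I → (A ⥤ D') ⥤ (A ⥤ D)}
    {θ : ∀ i, Prestrength (H i)} (h : ∀ i, IsStrength (θ i)) :
    IsStrength (Prestrength.sum θ) :=
  .of_app (fun X a => congrArg Limits.Sigma.map (funext fun i => (h i).unit_app X a))
    fun X Z' Z a =>
      (congrArg Limits.Sigma.map (funext fun i => (h i).comp_app X Z' Z a)).trans
        ((Sigma.map_comp_map _ _).symm.trans (whisker_eq _ (Sigma.map_comp_map _ _).symm))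

end StrengthLaws

/-! ### Strength laws for binding signatures -/

section SignatureStrength

variable (C : Type u) [Category.{v} C] {S : Type x} [HasCoproducts.{w} C] [HasTerminal C]
  [HasBinaryCoproducts C]

/-- Each law is checked on the two summands. For composition, the old variables need only
functoriality of `Z'`, since `δ_Z` after the inclusion of `Z X` is `Z` of the inclusion of `X`. The
new variable needs naturality of the point of `Z'` along `δ_Z`, which yields the composite point. -/
lemma isDistributiveLaw_optionDistr (s : S) : IsDistributiveLaw (optionDistr.{w} C s) where
  unit X := by
    ext ⟨t⟩ : 2
    refine coprod.hom_ext ?_ ?_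
    · exact (coprod.inl_desc _ _).trans (Category.comp_id _).symm
    · exact coprod.inr_desc _ _
  comp Z' Z X := by
    ext ⟨t⟩ : 2
    refine coprod.hom_ext ?_ ?_
    · refine (coprod.inl_desc _ _).trans (.trans ?_ (coprod.inl_desc_assoc _ _ _).symm)
      have h : Z.functor.map ((optionInl.{w} C s).app X) =
          (optionInl.{w} C s).app (Z.functor.obj X) ≫ ((optionDistr.{w} C s).app Z).app X := by
        ext ⟨t⟩ : 2
        exact (coprod.inl_desc _ _).symm
      refine (NatTrans.congr_app (congrArg Z'.functor.map h) ⟨t⟩).trans ?_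
      exact NatTrans.congr_app (Z'.functor.map_comp _ _) ⟨t⟩
    · refine (coprod.inr_desc _ _).trans (.trans ?_ (coprod.inr_desc_assoc _ _ _).symm)
      refine .trans ?_ (Category.assoc _ _ _).symm
      have h := NatTrans.congr_app (Z'.point.naturality (((optionDistr.{w} C s).app Z).app X)) ⟨t⟩
      refine .trans ?_ (whisker_eq _ h)
      refine .trans ?_ (Category.assoc _ _ _)
      refine .trans ?_ (eq_whisker (coprod.inr_desc _ _).symm _)
      exact (Category.assoc _ _ _).symm

lemma isDistributiveLaw_optionListDistr :
    ∀ ℓ : List S, IsDistributiveLaw (optionListDistr.{w} C ℓ)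
  | [] => .id
  | s :: ℓ => isDistributiveLaw_comp (isDistributiveLaw_optionDistr C s) 
    (isDistributiveLaw_optionListDistr ℓ)

lemma isStrength_argStrength (a : List S × S) : IsStrength (argStrength.{w} C a) :=
  (IsStrength.precomp (isDistributiveLaw_optionListDistr C a.1)).postcomp _

variable [HasBinaryProducts C]

lemma isStrength_argsStrength : ∀ l : List (List S × S), IsStrength (argsStrength.{w} C l)
  | [] => .const _
  | [a] => isStrength_argStrength C a
  | a :: b :: l => (isStrength_argStrength C a).prod (isStrength_argsStrength (b :: l))

lemma MultiSortedSig.isStrength_strength (σ : MultiSortedSig.{w} S) :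
    IsStrength (σ.strength C) :=
  IsStrength.sum fun i => (isStrength_argsStrength.{w} C (σ.ar i).1).postcomp _

end SignatureStrength

/-! ### Cocontinuity of signature functors -/

section Cocontinuity

variable {B : Type u₁} [Category.{v₁} B] {D : Type u₂} [Category.{v₂} D]

/-- The pointwise coproduct of a family of functors. -/
def sigmaFunctor {I : Type w} [HasCoproductsOfShape I D] (F : I → B ⥤ D) : B ⥤ D where
  obj b := ∐ fun i => (F i).obj b
  map f := Limits.Sigma.map fun i => (F i).map f

/-- Coproducts commute with colimits. -/
lemma preservesColimitsOfShape_sigmaFunctor {I : Type w} [HasCoproductsOfShape I D]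
    (F : I → B ⥤ D) (J : Type u₃) [Category.{v₃} J] (hF : ∀ i, PreservesColimitsOfShape J (F i)) :
    PreservesColimitsOfShape J (sigmaFunctor F) where
  preservesColimit {K} := ⟨fun {c} hc => ⟨
    let γ (i : I) : K ⋙ F i ⟶ K ⋙ sigmaFunctor F :=
      { app := fun j => Sigma.ι (fun i => (F i).obj (K.obj j)) i
        naturality := fun j j' f => (Sigma.ι_map (fun i => (F i).map (K.map f)) i).symm }
    -- A cocone over the coproduct functor restricts to one over each summand `F i`, whose colimit
    -- is known.
    let d (s : Cocone (K ⋙ sigmaFunctor F)) (i : I) : (F i).obj c.pt ⟶ s.pt :=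
      (isColimitOfPreserves (F i) hc).desc ⟨s.pt, γ i ≫ s.ι⟩
    have hd (s : Cocone (K ⋙ sigmaFunctor F)) (i : I) (j : J) : (F i).map (c.ι.app j) ≫ d s i =
        Sigma.ι (fun i => (F i).obj (K.obj j)) i ≫ s.ι.app j :=
      (isColimitOfPreserves (F i) hc).fac ⟨s.pt, γ i ≫ s.ι⟩ j
    { desc := fun s => Sigma.desc (d s)
      fac := fun s j => by
        refine Sigma.hom_ext (f := fun i => (F i).obj (K.obj j)) _ _ fun i => ?_
        refine (Sigma.ι_map_assoc (fun i => (F i).map (c.ι.app j)) i _).trans ?_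
        exact (whisker_eq _ (Sigma.ι_desc (d s) i)).trans (hd s i j)
      uniq := fun s m hm => by
        refine Sigma.hom_ext (f := fun i => (F i).obj c.pt) _ _ fun i => ?_
        refine .trans ?_ (Sigma.ι_desc (d s) i).symm
        refine (isColimitOfPreserves (F i) hc).hom_ext fun j => ?_
        refine .trans ?_ (hd s i j).symm
        refine .trans ?_ (whisker_eq (Sigma.ι (fun i => (F i).obj (K.obj j)) i) (hm j))
        exact (Sigma.ι_map_assoc (fun i => (F i).map (c.ι.app j)) i m).symm }⟩⟩

/-- Constant functors preserve connected colimits. -/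
lemma preservesColimitsOfShape_const (J : Type u₃) [Category.{v₃} J] [IsConnected J] (d : D) :
    PreservesColimitsOfShape J ((Functor.const B).obj d) where
  preservesColimit := ⟨fun _ => ⟨(isColimitConstCocone J d).ofIsoColimit
    (Cocone.ext (Iso.refl _) fun _ => Category.comp_id _)⟩⟩

/-- In the category of types, binary products commute with filtered colimits. -/
lemma preservesColimitsOfShape_of_bijective_types (J : Type u₃) [Category.{v₃} J] [IsFiltered J]
    {F G K : B ⥤ Type w} (p : K ⟶ F) (q : K ⟶ G)
    (hb : ∀ b, Function.Bijective fun z : K.obj b => (p.app b z, q.app b z))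
    [PreservesColimitsOfShape J F] [PreservesColimitsOfShape J G] :
    PreservesColimitsOfShape J K where
  preservesColimit {L} := ⟨fun {c} hc => by
    have hF := isColimitOfPreserves F hc
    have hG := isColimitOfPreserves G hc
    have hp {b b' : B} (f : b ⟶ b') (z : K.obj b) :
        p.app b' (K.map f z) = F.map f (p.app b z) := NatTrans.naturality_apply p f z
    have hq {b b' : B} (f : b ⟶ b') (z : K.obj b) :
        q.app b' (K.map f z) = G.map f (q.app b z) := NatTrans.naturality_apply q f z
    have hext {b : B} {z z' : K.obj b} (h₁ : p.app b z = p.app b z')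
        (h₂ : q.app b z = q.app b z') : z = z' := (hb b).1 (Prod.ext h₁ h₂)
    have mF {i j k : J} (f : i ⟶ j) (g : j ⟶ k) (y : F.obj (L.obj i)) :
        F.map (L.map (f ≫ g)) y = F.map (L.map g) (F.map (L.map f) y) :=
      Functor.map_comp_apply (L ⋙ F) f g y
    have mG {i j k : J} (f : i ⟶ j) (g : j ⟶ k) (y : G.obj (L.obj i)) :
        G.map (L.map (f ≫ g)) y = G.map (L.map g) (G.map (L.map f) y) :=
      Functor.map_comp_apply (L ⋙ G) f g y
    have wF {i j : J} (f : i ⟶ j) (y : F.obj (L.obj i)) :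
        F.map (c.ι.app j) (F.map (L.map f) y) = F.map (c.ι.app i) y :=
      ConcreteCategory.congr_hom ((F.mapCocone c).w f) y
    have wG {i j : J} (f : i ⟶ j) (y : G.obj (L.obj i)) :
        G.map (c.ι.app j) (G.map (L.map f) y) = G.map (c.ι.app i) y :=
      ConcreteCategory.congr_hom ((G.mapCocone c).w f) y
    -- A cocone of sets over a filtered shape is a colimit if it is jointly surjective and elements
    -- identified in the apex are already identified at a later stage.
    refine ⟨Types.FilteredColimit.isColimitOf' _ _ (fun z => ?_) (fun i z z' e => ?_)⟩
    · obtain ⟨i, x, hx⟩ := Types.jointly_surjective_of_isColimit hF (p.app _ z)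
      obtain ⟨j, y, hy⟩ := Types.jointly_surjective_of_isColimit hG (q.app _ z)
      -- The two coordinates have representatives at different stages; they can be paired at a
      -- common later one.
      obtain ⟨k, f, g, -⟩ := IsFilteredOrEmpty.cocone_objs i j
      obtain ⟨t, ht⟩ := (hb (L.obj k)).2 (F.map (L.map f) x, G.map (L.map g) y)
      have h₁ : p.app (L.obj k) t = F.map (L.map f) x := congrArg Prod.fst ht
      have h₂ : q.app (L.obj k) t = G.map (L.map g) y := congrArg Prod.snd ht
      refine ⟨k, t, hext ?_ ?_⟩
      · refine .trans ?_ (hp (c.ι.app k) t).symm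
        rw [h₁, wF]
        exact hx.symm
      · refine .trans ?_ (hq (c.ι.app k) t).symm
        rw [h₂, wG]
        exact hy.symm
    · have e₁ : F.map (c.ι.app i) (p.app _ z) = F.map (c.ι.app i) (p.app _ z') := by
        rw [← hp, ← hp]
        exact congrArg _ e
      have e₂ : G.map (c.ι.app i) (q.app _ z) = G.map (c.ι.app i) (q.app _ z') := by
        rw [← hq, ← hq]
        exact congrArg _ e
      obtain ⟨j, f, hf⟩ := (Types.FilteredColimit.isColimit_eq_iff' hF _ _).1 e₁
      obtain ⟨k, g, hg⟩ := (Types.FilteredColimit.isColimit_eq_iff' hG _ _).1 e₂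
      -- The coordinates become equal along different arrows `f` and `g` out of `i`. An upper bound
      -- of `j` and `k` is not enough: the two paths from `i` must also agree.
      obtain ⟨l, f', g', h⟩ := IsFiltered.span f g
      refine ⟨l, f ≫ f', hext ?_ ?_⟩
      · refine (hp (L.map (f ≫ f')) z).trans (.trans ?_ (hp (L.map (f ≫ f')) z').symm)
        rw [mF, mF]
        exact congrArg _ hf
      · refine (hq (L.map (f ≫ f')) z).trans (.trans ?_ (hq (L.map (f ≫ f')) z').symm)
        rw [h, mG, mG]
        exact congrArg _ hg⟩

end Cocontinuity

/-! ### Cocontinuity of the building blocks of a signature -/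

section SignatureCocontinuity

variable {A : Type u₁} [Category.{v₁} A] {D' : Type u₂} [Category.{v₂} D']
  {D : Type u₃} [Category.{v₃} D]

lemma preservesColimitsOfShape_sumSig (J : Type u) [Category.{v} J] [HasColimitsOfShape J D]
    {I : Type w} [HasCoproductsOfShape I D] (H : I → (A ⥤ D') ⥤ (A ⥤ D))
    (hH : ∀ i, PreservesColimitsOfShape J (H i)) : PreservesColimitsOfShape J (sumSig H) :=
  preservesColimitsOfShape_of_evaluation _ _ fun a =>
    preservesColimitsOfShape_sigmaFunctor (fun i => H i ⋙ (evaluation A D).obj a) J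
      fun _ => inferInstance

lemma preservesColimitsOfShape_prodSig (J : Type u) [Category.{v} J] [IsFiltered J]
    [HasColimitsOfShape J (Type w)] (H₁ H₂ : (A ⥤ D') ⥤ (A ⥤ Type w))
    [PreservesColimitsOfShape J H₁] [PreservesColimitsOfShape J H₂] :
    PreservesColimitsOfShape J (prodSig H₁ H₂) :=
  preservesColimitsOfShape_of_evaluation _ _ fun a => by
    refine preservesColimitsOfShape_of_bijective_types J
      (F := H₁ ⋙ (evaluation A _).obj a) (G := H₂ ⋙ (evaluation A _).obj a)
      { app := fun X => (Limits.prod.fst : (H₁.obj X).obj a ⨯ (H₂.obj X).obj a ⟶ _)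
        naturality := fun X Y f => prod.map_fst _ _ }
      { app := fun X => (Limits.prod.snd : (H₁.obj X).obj a ⨯ (H₂.obj X).obj a ⟶ _)
        naturality := fun X Y f => prod.map_snd _ _ } fun X => ?_
    -- Pairing the projections is the canonical bijection from the categorical product to the
    -- product of sets.
    have h : (fun z : ↑((H₁.obj X).obj a ⨯ (H₂.obj X).obj a) =>
        ((Limits.prod.fst : (H₁.obj X).obj a ⨯ (H₂.obj X).obj a ⟶ _) z,
          (Limits.prod.snd : (H₁.obj X).obj a ⨯ (H₂.obj X).obj a ⟶ _) z)) =
        (Types.binaryProductIso ((H₁.obj X).obj a) ((H₂.obj X).obj a)).toEquiv := by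
      funext z
      exact (Prod.ext
        (ConcreteCategory.congr_hom (Types.binaryProductIso_hom_comp_fst _ _) z)
        (ConcreteCategory.congr_hom (Types.binaryProductIso_hom_comp_snd _ _) z)).symm
    have hb := (Types.binaryProductIso ((H₁.obj X).obj a) ((H₂.obj X).obj a)).toEquiv.bijective
    rw [← h] at hb
    exact hb

/-- At each sort the hat functor is a coproduct of copies of the identity functor. -/
lemma preservesColimitsOfShape_hatFunctor (C : Type u) [Category.{v} C] {S : Type x}
    [HasCoproducts.{w} C] (J : Type u₁) [Category.{v₁} J] [HasColimitsOfShape J C] (s : S) :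
    PreservesColimitsOfShape J (hatFunctor.{w} C s) :=
  preservesColimitsOfShape_of_evaluation _ _ fun t =>
    preservesColimitsOfShape_sigmaFunctor (fun _ : EqIdx.{w} s t.as => 𝟭 C) J
      fun _ => inferInstance

/-- Colimits of functors are pointwise, so precomposition with `option ℓ` preserves them whatever
`option ℓ` is; evaluation at a sort preserves them too. -/
lemma preservesColimitsOfShape_argFunctor (C : Type u) [Category.{v} C] {S : Type x}
    [HasCoproducts.{w} C] [HasTerminal C] [HasBinaryCoproducts C] (J : Type u₁) [Category.{v₁} J]
    [HasColimitsOfShape J C] (a : List S × S) :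
    PreservesColimitsOfShape J (argFunctor.{w} C a) := by
  unfold argFunctor
  infer_instance

/-- Filteredness enters twice: it makes `J` connected, which handles the empty product, and it lets
binary products of sets commute with the colimit. -/
lemma preservesColimitsOfShape_argsFunctor_types {S : Type x} (J : Type u) [Category.{v} J]
    [IsFiltered J] [HasColimitsOfShape J (Type w)] :
    ∀ l : List (List S × S), PreservesColimitsOfShape J (argsFunctor.{w} (Type w) l)
  | [] =>
    have : IsConnected J := IsFiltered.isConnected J
    preservesColimitsOfShape_const J _
  | [a] => preservesColimitsOfShape_argFunctor _ J a
  | a :: b :: l =>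
    have := preservesColimitsOfShape_argFunctor.{w} (Type w) J a
    have := preservesColimitsOfShape_argsFunctor_types J (b :: l)
    preservesColimitsOfShape_prodSig J _ _

/-- Over the category of types, signature functors preserve filtered colimits. -/
theorem MultiSortedSig.preservesColimitsOfShape_functor_types {S : Type x}
    (σ : MultiSortedSig.{w} S) (J : Type u) [Category.{v} J] [IsFiltered J]
    [HasColimitsOfShape J (Type w)] :
    PreservesColimitsOfShape J (σ.functor (Type w)) :=
  preservesColimitsOfShape_sumSig J _ fun i =>
    have := preservesColimitsOfShape_argsFunctor_types.{w} J (σ.ar i).1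
    have := preservesColimitsOfShape_hatFunctor.{w} (Type w) J (σ.ar i).2
    inferInstanceAs (PreservesColimitsOfShape J (argsFunctor.{w} (Type w) (σ.ar i).1 ⋙
      (Functor.whiskeringRight _ _ _).obj (hatFunctor.{w} (Type w) (σ.ar i).2)))

end SignatureCocontinuity

end MultiSorted

end

theorem mainTheorem1 {S : Type x} (σ : MultiSortedSig.{w} S) :
    -- every ω-cocontinuous signature with strength has a term monad
    (∀ (A : Type u) [Category.{v} A] [HasBinaryCoproducts A] [HasInitial A]
        [HasColimitsOfShape ℕ A] (H : (A ⥤ A) ⥤ (A ⥤ A)) (θ : Prestrength H),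
        IsStrength θ → PreservesColimitsOfShape ℕ H → HasTermMonad θ) ∧
    -- the signature functor of a multi-sorted binding signature has a strength
    (∀ (C : Type u) [Category.{v} C] [HasTerminal C] [HasBinaryProducts C]
        [HasBinaryCoproducts C] [HasCoproducts.{w} C],
        (∀ s : S, IsDistributiveLaw (optionDistr.{w} C s)) ∧
        (∀ ℓ : List S, IsDistributiveLaw (optionListDistr.{w} C ℓ)) ∧
        IsStrength (σ.strength C) ∧
        -- and a term monad, if it is ω-cocontinuous
        ∀ [HasInitial C] [HasColimitsOfShape ℕ C],
          PreservesColimitsOfShape ℕ (σ.functor C) → HasTermMonad (σ.strength C)) ∧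
    -- in particular over the category of sets
    (PreservesColimitsOfShape ℕ (σ.functor (Type w)) ∧
      HasTermMonad (σ.strength (Type w))) := by
  have h := σ.preservesColimitsOfShape_functor_types ℕ
  refine ⟨fun A _ _ _ _ H θ => hasTermMonad_of_isStrength, fun C _ _ _ _ _ => ?_,
    h, hasTermMonad_of_isStrength (σ.isStrength_strength _) h⟩
  exact ⟨isDistributiveLaw_optionDistr C, isDistributiveLaw_optionListDistr C,
    σ.isStrength_strength C, hasTermMonad_of_isStrength (σ.isStrength_strength C)⟩
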